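/- Let $P$ be a probabilistic program over finite sets $X$ of real-valued program variables and $R$ of sampling variables, built by sequential composition from $\mathbf{skip}$, simultaneous assignments $x_{n_1},\dots,x_{n_k}:=E_1,\dots,E_k$ with polynomials $E_j$ over $X\cup R$, while-loops guarded by propositional polynomial predicates over $X$ (Boolean combinations of polynomial inequalities), and if-statements whose guard is such a predicate, a probabilistic choice $\mathbf{prob}(p)$ with $p\in(0,1)$, or a demonic choice $\star$. Each sampling variable $r$ has a probability distribution on $\mathbb{R}$ and a non-empty bounded interval $\mathrm{Supp}_r$ that contains its value with probability $1$. Let $L$ be the finite set of labels of the control flow graph of $P$ (one label per assignment, skip, if- and while-statement), partitioned into assignment, probabilistic, branching and demonic labels; let $\bot\notin L$ be the terminal label, $L_\bot=L\cup\{\bot\}$, $\ell_0$ the label of the first statement and $x_0\in\mathbb{R}^X$ the initial valuation. An assignment label $\ell$ has a single transition $(\ell,f,\ell')$ with update function $f\colon\mathbb{R}^X\times\mathbb{R}^R\to\mathbb{R}^X$; a probabilistic label has transitions $(\ell,p,\ell_1),(\ell,1-p,\ell_2)$; a branching label $(\ell,\phi,\ell_1),(\ell,\neg\phi,\ell_2)$;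 a demonic label $(\ell,\star,\ell_1),(\ell,\star,\ell_2)$. A configuration is a pair $(\ell,x)\in L_\bot\times\mathbb{R}^X$. A (measurable) scheduler $\sigma$ assigns to each finite path that starts in $(\ell_0,x_0)$ and ends in a demonic label one of the transitions of that label. Under $\sigma$ the program starts in $(\ell_0,x_0)$ and moves step by step: an assignment label draws fresh independent samples $r$ of all sampling variables and moves to $(\ell',f(x,r))$, the other labels keep $x$ and move along the transition chosen at random with the given probabilities, by the predicate that holds at $x$, or by $\sigma$; $\bot$ is absorbing. This induces a probability measure $\mathbb{P}^\sigma$ on runs with expectation $\mathbb{E}^\sigma$. Let $T_P\in\mathbb{N}_0\cup\{\infty\}$ be the first time at which the label is $\bot$, and $\mathsf{ET}(P)=\sup_\sigma\mathbb{E}^\sigma(T_P)$. Let $I$ be a polynomial invariant, i.e. a map assigning to each label a propositional polynomial predicate over $X$ such that $x\models I(\ell)$ for every configuration $(\ell,x)$ reachable from $(\ell_0,x_0)$ by a finite path with sampled values in the intervals $\mathrm{Supp}_r$. For $\eta\colon L_\bot\times\mathbb{R}^X\to\mathbb{R}$ define $\mathrm{pre}_\eta(\ell,x)$ as $\mathbb{E}_r\,\eta(\ell',f(x,r))$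 (independent samples $r$), $p\,\eta(\ell_1,x)+(1-p)\,\eta(\ell_2,x)$, $\eta(\ell_1,x)$ if $x\models\phi$ and $\eta(\ell_2,x)$ otherwise, and $\max\{\eta(\ell_1,x),\eta(\ell_2,x)\}$ at an assignment, probabilistic, branching and demonic label, respectively. Suppose that $\eta$ is a $d$-degree polynomial ranking supermartingale for $(P,I)$ with constants $\epsilon>0$ and $K\le-\epsilon$, that is, for all $x\in\mathbb{R}^X$: (C1) for each $\ell\in L_\bot$, $\eta(\ell,\cdot)$ is a polynomial of total degree at most $d$; (C2) if $\ell\in L$ and $x\models I(\ell)$, then $\eta(\ell,x)\ge0$; (C3) $\eta(\bot,x)=K$; (C4) if $\ell\in L$ and $x\models I(\ell)$, and, in case $\ell$ is a branching label, the predicate of some transition of $\ell$ with target different from $\bot$ holds at $x$, then $\mathrm{pre}_\eta(\ell,x)\le\eta(\ell,x)-\epsilon$. Then $P$ terminates almost surely under every scheduler, i.e. $\mathbb{P}^\sigma(T_P<\infty)=1$ for all $\sigma$, and $$\mathsf{ET}(P)\le\frac{\eta(\ell_0,x_0)-K}{\epsilon}.$$ -/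

import Mathlib

noncomputable section

namespace PP

open MeasureTheory ProbabilityTheory

/-! ### Propositional polynomial predicates -/

/-- Propositional polynomial predicates over the variables `X`. -/
inductive Pred (X : Type*) where
  | tru : Pred X
  | fls : Pred X
  | lt (g₁ g₂ : MvPolynomial X ℝ) : Pred X
  | le (g₁ g₂ : MvPolynomial X ℝ) : Pred X
  | gt (g₁ g₂ : MvPolynomial X ℝ) : Pred X
  | ge (g₁ g₂ : MvPolynomial X ℝ) : Pred X
  | not (φ : Pred X) : Pred X
  | and (φ ψ : Pred X) : Pred X
  | or (φ ψ : Pred X) : Pred X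

/-- The satisfaction relation `x ⊨ φ`. -/
def Pred.Sat {X : Type*} (x : X → ℝ) : Pred X → Prop
  | .tru => True
  | .fls => False
  | .lt g₁ g₂ => MvPolynomial.eval x g₁ < MvPolynomial.eval x g₂
  | .le g₁ g₂ => MvPolynomial.eval x g₁ ≤ MvPolynomial.eval x g₂
  | .gt g₁ g₂ => MvPolynomial.eval x g₁ > MvPolynomial.eval x g₂
  | .ge g₁ g₂ => MvPolynomial.eval x g₁ ≥ MvPolynomial.eval x g₂
  | .not φ => ¬ φ.Sat x
  | .and φ ψ => φ.Sat x ∧ ψ.Sat x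
  | .or φ ψ => φ.Sat x ∨ ψ.Sat x

/-! ### Sampling variables -/

/-- Bounded sampling variables: each `r : R` has a probability distribution on `ℝ` (equivalently,
a cumulative distribution function) and a non-empty bounded interval that contains the sampled
values with probability one. -/
structure Sampling (R : Type*) where
  law : R → Measure ℝ
  isProb : ∀ r, IsProbabilityMeasure (law r)
  supp : R → Set ℝ
  supp_nonempty : ∀ r, (supp r).Nonempty
  supp_interval : ∀ r, (supp r).OrdConnected
  supp_bounded : ∀ r, Bornology.IsBounded (supp r)
  ae_mem_supp : ∀ r, ∀ᵐ z ∂(law r), z ∈ supp r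

instance Sampling.instIsProb {R : Type*} (S : Sampling R) (r : R) :
    IsProbabilityMeasure (S.law r) := S.isProb r

/-- The joint law of one (independent) sample of all sampling variables. -/
def Sampling.joint {R : Type*} [Fintype R] (S : Sampling R) : Measure (R → ℝ) :=
  Measure.pi S.law

instance Sampling.instIsProbJoint {R : Type*} [Fintype R] (S : Sampling R) :
    IsProbabilityMeasure S.joint := by
  unfold Sampling.joint; infer_instance

/-! ### Control flow graphs -/

/-- A polynomial update function `ℝ^X × ℝ^R → ℝ^X`. -/
abbrev Update (X R : Type*) := X → MvPolynomial (X ⊕ R) ℝ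

/-- The value `f(x, r)` of an update function. -/
def Update.apply {X R : Type*} (f : Update X R) (x : X → ℝ) (r : R → ℝ) : X → ℝ :=
  fun i => MvPolynomial.eval (Sum.elim x r) (f i)

/-- Labels including the terminal label: `none` is the terminal label `⊥`, which is not in `L`. -/
abbrev LabelBot (L : Type*) := Option L

instance LabelBot.instMeasurableSpace {L : Type*} : MeasurableSpace (LabelBot L) := ⊤

instance LabelBot.instDiscrete {L : Type*} : DiscreteMeasurableSpace (LabelBot L) :=
  ⟨fun _ => trivial⟩

/-- The kind of a label (assignment, probabilistic, branching, demonic) together with its outgoing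
transitions:
* `assign f ℓ'`: the only transition is `(ℓ, f, ℓ')`;
* `prob p ℓ₁ ℓ₂`: the transitions are `(ℓ, p, ℓ₁)` and `(ℓ, 1 - p, ℓ₂)`;
* `branch φ ℓ₁ ℓ₂`: the transitions are `(ℓ, φ, ℓ₁)` and `(ℓ, ¬φ, ℓ₂)`;
* `demonic ℓ₁ ℓ₂`: the transitions are `(ℓ, ⋆, ℓ₁)` and `(ℓ, ⋆, ℓ₂)`. -/
inductive Node (L X R : Type*) where
  | assign (f : Update X R) (l' : LabelBot L) : Node L X R
  | prob (p : Set.Ioo (0 : ℝ) 1) (l₁ l₂ : LabelBot L) : Node L X R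
  | branch (φ : Pred X) (l₁ l₂ : LabelBot L) : Node L X R
  | demonic (l₁ l₂ : LabelBot L) : Node L X R

/-- Renaming the target labels of the transitions. -/
def Node.map {L L' X R : Type*} (g : LabelBot L → LabelBot L') : Node L X R → Node L' X R
  | .assign f l' => .assign f (g l')
  | .prob p l₁ l₂ => .prob p (g l₁) (g l₂)
  | .branch φ l₁ l₂ => .branch φ (g l₁) (g l₂)
  | .demonic l₁ l₂ => .demonic (g l₁) (g l₂)

/-- A control flow graph with label set `L`, program variables `X`, sampling variables `R`. -/
structure CFG (L X R : Type*) where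
  node : L → Node L X R

/-! ### Program syntax and its control flow graph -/

/-- Guards of if-statements: `⋆`, `prob(p)` with `p ∈ (0,1)`, or a polynomial predicate. -/
inductive Guard (X : Type*) where
  | star : Guard X
  | prob (p : Set.Ioo (0 : ℝ) 1) : Guard X
  | pred (φ : Pred X) : Guard X

/-- Probabilistic programs. In `assign E`, the variables `x` with `E x = some e` are simultaneously
assigned the values of the polynomial expressions `e`; the other variables are left unchanged;
`loop φ P` is `while φ do P od`. -/
inductive Program (X R : Type*) where
  | skip : Program X R
  | assign (E : X → Option (MvPolynomial (X ⊕ R) ℝ)) : Program X R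
  | seq (P Q : Program X R) : Program X R
  | ite (B : Guard X) (P Q : Program X R) : Program X R
  | loop (φ : Pred X) (P : Program X R) : Program X R

namespace Program

variable {X R : Type*}

/-- The (non-terminal) labels of a program: one for each atomic statement, if-statement and
while-statement. -/
def Label : Program X R → Type
  | skip => Unit
  | assign _ => Unit
  | seq P Q => P.Label ⊕ Q.Label
  | ite _ P Q => Unit ⊕ (P.Label ⊕ Q.Label)
  | loop _ P => Unit ⊕ P.Label

instance instFiniteLabel : (P : Program X R) → Finite P.Label
  | skip => inferInstanceAs (Finite Unit)
  | assign _ => inferInstanceAs (Finite Unit)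
  | seq P Q =>
    have := instFiniteLabel P
    have := instFiniteLabel Q
    inferInstanceAs (Finite (P.Label ⊕ Q.Label))
  | ite _ P Q =>
    have := instFiniteLabel P
    have := instFiniteLabel Q
    inferInstanceAs (Finite (Unit ⊕ (P.Label ⊕ Q.Label)))
  | loop _ P =>
    have := instFiniteLabel P
    inferInstanceAs (Finite (Unit ⊕ P.Label))

/-- The label of the first statement to be executed. -/
def entry : (P : Program X R) → P.Label
  | skip => ()
  | assign _ => ()
  | seq P _ => Sum.inl P.entry
  | ite _ _ _ => Sum.inl ()
  | loop _ _ => Sum.inl ()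

/-- The transitions of each label. In `P; Q` the terminal label of `P` is identified with the entry
of `Q`; in `while φ do P od` the terminal label of `P` is identified with the loop head. -/
def node : (P : Program X R) → P.Label → Node P.Label X R
  | skip, _ => .assign (fun i => MvPolynomial.X (Sum.inl i)) none
  | assign E, _ => .assign (fun i => (E i).getD (MvPolynomial.X (Sum.inl i))) none
  | seq P Q, Sum.inl l =>
    (P.node l).map fun
      | none => some (Sum.inr Q.entry)
      | some l' => some (Sum.inl l')
  | seq _ Q, Sum.inr l => (Q.node l).map (Option.map Sum.inr)
  | ite B P Q, Sum.inl () =>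
    match B with
    | .star => .demonic (some (Sum.inr (Sum.inl P.entry))) (some (Sum.inr (Sum.inr Q.entry)))
    | .prob p => .prob p (some (Sum.inr (Sum.inl P.entry))) (some (Sum.inr (Sum.inr Q.entry)))
    | .pred φ => .branch φ (some (Sum.inr (Sum.inl P.entry))) (some (Sum.inr (Sum.inr Q.entry)))
  | ite _ P _, Sum.inr (Sum.inl l) => (P.node l).map (Option.map fun l' => Sum.inr (Sum.inl l'))
  | ite _ _ Q, Sum.inr (Sum.inr l) => (Q.node l).map (Option.map fun l' => Sum.inr (Sum.inr l'))
  | loop φ P, Sum.inl () => .branch φ (some (Sum.inr P.entry)) none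
  | loop _ P, Sum.inr l =>
    (P.node l).map fun
      | none => some (Sum.inl ())
      | some l' => some (Sum.inr l')

/-- The control flow graph of a program. -/
def cfg (P : Program X R) : CFG P.Label X R := ⟨P.node⟩

end Program

/-! ### Configurations, reachability, invariants -/

/-- Configurations `(ℓ, x)` with `ℓ ∈ L ∪ {⊥}`. -/
abbrev Config (L X : Type*) := LabelBot L × (X → ℝ)

/-- `G.Step S c c'`: the configuration `c'` may directly follow `c` on a path. -/
def CFG.Step {L X R : Type*} (G : CFG L X R) (S : Sampling R) : Config L X → Config L X → Prop
  | (none, x), c' => c' = (none, x)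
  | (some l, x), c' =>
    match G.node l with
    | .assign f l' => ∃ r : R → ℝ, (∀ i, r i ∈ S.supp i) ∧ c' = (l', f.apply x r)
    | .prob _ l₁ l₂ => c' = (l₁, x) ∨ c' = (l₂, x)
    | .branch φ l₁ l₂ => (φ.Sat x ∧ c' = (l₁, x)) ∨ (¬ φ.Sat x ∧ c' = (l₂, x))
    | .demonic l₁ l₂ => c' = (l₁, x) ∨ c' = (l₂, x)

/-- `c` is reachable from `c₀`, i.e. some finite path leads from `c₀` to `c`. -/
def CFG.Reachable {L X R : Type*} (G : CFG L X R) (S : Sampling R) (c₀ c : Config L X) : Prop :=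
  Relation.ReflTransGen (G.Step S) c₀ c

/-- `I` is a polynomial invariant with respect to the initial configuration `c₀`. -/
def CFG.IsInvariant {L X R : Type*} (G : CFG L X R) (S : Sampling R) (c₀ : Config L X)
    (I : LabelBot L → Pred X) : Prop :=
  ∀ l x, G.Reachable S c₀ (l, x) → (I l).Sat x

/-! ### Schedulers and the induced probability measure on runs -/

/-- A scheduler: to every history `c₀, …, cₙ` ending in a demonic label it assigns one of the two
transitions of that label (`true` for the first, `false` for the second); its values at other
histories are irrelevant. Measurability is needed for the induced measure on runs to exist. -/
structure Scheduler (L X : Type*) where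
  choice : (n : ℕ) → (Finset.Iic n → Config L X) → Bool
  measurable_choice : ∀ n, Measurable (choice n)

open Classical in
/-- The law of the next configuration, given the current configuration and the choice `b` of the
scheduler (which matters only at demonic labels). -/
def CFG.stepLaw {L X R : Type*} [Fintype R] (G : CFG L X R) (S : Sampling R) (b : Bool) :
    Config L X → Measure (Config L X)
  | (none, x) => Measure.dirac (none, x)
  | (some l, x) =>
    match G.node l with
    | .assign f l' => S.joint.map fun r => (l', f.apply x r)
    | .prob p l₁ l₂ =>
      ENNReal.ofReal p • Measure.dirac (l₁, x) + ENNReal.ofReal (1 - p) • Measure.dirac (l₂, x)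
    | .branch φ l₁ l₂ => if φ.Sat x then Measure.dirac (l₁, x) else Measure.dirac (l₂, x)
    | .demonic l₁ l₂ => Measure.dirac (if b then l₁ else l₂, x)

theorem Pred.measurableSet_sat {X : Type*} [Finite X] (φ : Pred X) :
    MeasurableSet {x : X → ℝ | φ.Sat x} := by
  have := Fintype.ofFinite X
  have hm : ∀ g : MvPolynomial X ℝ, Measurable fun x : X → ℝ => MvPolynomial.eval x g :=
    fun g => (MvPolynomial.continuous_eval g).measurable
  induction φ with
  | tru => exact MeasurableSet.univ
  | fls => exact MeasurableSet.empty
  | lt g₁ g₂ => exact measurableSet_lt (hm g₁) (hm g₂)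
  | le g₁ g₂ => exact measurableSet_le (hm g₁) (hm g₂)
  | gt g₁ g₂ => exact measurableSet_lt (hm g₂) (hm g₁)
  | ge g₁ g₂ => exact measurableSet_le (hm g₂) (hm g₁)
  | not φ ih => exact ih.compl
  | and φ ψ ih₁ ih₂ => exact ih₁.inter ih₂
  | or φ ψ ih₁ ih₂ => exact ih₁.union ih₂

theorem Update.measurable_apply {X R : Type*} [Finite X] [Finite R] (f : Update X R) :
    Measurable fun p : (X → ℝ) × (R → ℝ) => f.apply p.1 p.2 := by
  have := Fintype.ofFinite X
  have := Fintype.ofFinite R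
  refine measurable_pi_lambda _ fun i => ?_
  refine ((MvPolynomial.continuous_eval (f i)).comp (f := fun p : (X → ℝ) × (R → ℝ) =>
    (Sum.elim p.1 p.2 : X ⊕ R → ℝ)) ?_).measurable
  refine continuous_pi fun j => ?_
  cases j with
  | inl a => exact (continuous_apply a).comp continuous_fst
  | inr a => exact (continuous_apply a).comp continuous_snd

theorem Update.measurable_apply_right {X R : Type*} [Finite X] [Finite R] (f : Update X R)
    (x : X → ℝ) : Measurable fun r : R → ℝ => f.apply x r := by
  have h1 := Update.measurable_apply f
  have h2 : Measurable fun r : R → ℝ => (x, r) := measurable_const.prodMk measurable_id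
  have h3 := h1.comp h2
  simp only [Function.comp_def] at h3
  exact h3

theorem CFG.isProbabilityMeasure_stepLaw {L X R : Type*} [Finite X] [Fintype R]
    (G : CFG L X R) (S : Sampling R) (b : Bool) (c : Config L X) :
    IsProbabilityMeasure (G.stepLaw S b c) := by
  obtain ⟨l, x⟩ := c
  cases l with
  | none => simp only [CFG.stepLaw]; infer_instance
  | some l =>
    simp only [CFG.stepLaw]
    split
    · next f l' _ =>
      exact Measure.isProbabilityMeasure_map
        (measurable_const.prodMk (f.measurable_apply_right x)).aemeasurable
    · next p l₁ l₂ _ =>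
      constructor
      have h0 : (0 : ℝ) ≤ p := p.2.1.le
      have h1 : (0 : ℝ) ≤ 1 - p := by linarith [p.2.2]
      simp [← ENNReal.ofReal_add h0 h1]
    · split <;> infer_instance
    · infer_instance

theorem CFG.measurable_stepLaw {L X R : Type*} [Finite L] [Finite X] [Fintype R]
    (G : CFG L X R) (S : Sampling R) :
    Measurable fun p : Bool × Config L X => G.stepLaw S p.1 p.2 := by
  refine measurable_from_prod_countable_right fun b => ?_
  refine measurable_from_prod_countable_right fun l => ?_
  have hd : ∀ l' : LabelBot L, Measurable fun x : X → ℝ => Measure.dirac ((l', x) : Config L X) :=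
    fun l' => Measure.measurable_dirac.comp measurable_prodMk_left
  cases l with
  | none => exact hd none
  | some l =>
    simp only [CFG.stepLaw]
    split
    · next f l' _ =>
      refine Measure.measurable_of_measurable_coe _ fun s hs => ?_
      have hF : Measurable fun p : (X → ℝ) × (R → ℝ) => ((l', f.apply p.1 p.2) : Config L X) :=
        measurable_const.prodMk f.measurable_apply
      have h1 := measurable_measure_prodMk_left (ν := S.joint) (hF hs)
      have h2 : ∀ x : X → ℝ, (S.joint.map fun r => ((l', f.apply x r) : Config L X)) s =
          S.joint (Prod.mk x ⁻¹' ((fun p : (X → ℝ) × (R → ℝ) =>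
            ((l', f.apply p.1 p.2) : Config L X)) ⁻¹' s)) := fun x =>
        Measure.map_apply (measurable_const.prodMk (f.measurable_apply_right x)) hs
      simpa only [h2] using h1
    · next p l₁ l₂ _ =>
      refine Measure.measurable_of_measurable_coe _ fun s hs => ?_
      have h (l' : LabelBot L) := (Measure.measurable_coe hs).comp (hd l')
      exact ((h l₁).const_mul _).add ((h l₂).const_mul _)
    · next φ l₁ l₂ _ =>
      have hs := Pred.measurableSet_sat φ
      exact Measurable.ite (p := fun x : X → ℝ => φ.Sat x) hs (hd l₁) (hd l₂)
    · next l₁ l₂ _ =>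
      exact hd (if b then l₁ else l₂)

/-- The transition kernel at time `n` under a scheduler: the law of the configuration at time
`n + 1` given the history up to time `n`. -/
def CFG.stepKernel {L X R : Type*} [Finite L] [Finite X] [Fintype R] (G : CFG L X R)
    (S : Sampling R) (σ : Scheduler L X) (n : ℕ) :
    Kernel (Finset.Iic n → Config L X) (Config L X) where
  toFun h := G.stepLaw S (σ.choice n h) (h ⟨n, Finset.mem_Iic.2 le_rfl⟩)
  measurable' := (G.measurable_stepLaw S).comp
    ((σ.measurable_choice n).prodMk (measurable_pi_apply _))

instance CFG.instIsMarkovKernel {L X R : Type*} [Finite L] [Finite X] [Fintype R] (G : CFG L X R)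
    (S : Sampling R) (σ : Scheduler L X) (n : ℕ) : IsMarkovKernel (G.stepKernel S σ n) :=
  ⟨fun _ => G.isProbabilityMeasure_stepLaw S _ _⟩

/-- The probability measure on sequences of configurations induced by the scheduler `σ` and the
initial configuration `c₀`. -/
def CFG.runMeasure {L X R : Type*} [Finite L] [Finite X] [Fintype R] (G : CFG L X R)
    (S : Sampling R) (c₀ : Config L X) (σ : Scheduler L X) : Measure (ℕ → Config L X) :=
  Kernel.traj (X := fun _ => Config L X) (G.stepKernel S σ) 0 (fun _ => c₀)

/-! ### Termination -/

/-- The termination time of a run: the least `n` with `ℓₙ = ⊥`, and `∞` if there is none. -/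
def terminationTime {L X : Type*} (ω : ℕ → Config L X) : ENNReal :=
  ⨅ (n : ℕ) (_ : (ω n).1 = none), (n : ENNReal)

/-- Almost-sure termination under every scheduler. -/
def CFG.ASTerminating {L X R : Type*} [Finite L] [Finite X] [Fintype R] (G : CFG L X R)
    (S : Sampling R) (c₀ : Config L X) : Prop :=
  ∀ σ : Scheduler L X, G.runMeasure S c₀ σ {ω | terminationTime ω < ⊤} = 1

/-- The worst-case expected termination time. -/
def CFG.ET {L X R : Type*} [Finite L] [Finite X] [Fintype R] (G : CFG L X R)
    (S : Sampling R) (c₀ : Config L X) : ENNReal :=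
  ⨆ σ : Scheduler L X, ∫⁻ ω, terminationTime ω ∂(G.runMeasure S c₀ σ)

/-! ### Polynomial ranking supermartingales -/

open Classical in
/-- The pre-expectation of `η`. -/
def CFG.preExp {L X R : Type*} [Fintype R] (G : CFG L X R) (S : Sampling R)
    (η : LabelBot L → (X → ℝ) → ℝ) : LabelBot L → (X → ℝ) → ℝ
  | none, x => η none x
  | some l, x =>
    match G.node l with
    | .assign f l' => ∫ r, η l' (f.apply x r) ∂S.joint
    | .prob p l₁ l₂ => p * η l₁ x + (1 - p) * η l₂ x
    | .branch φ l₁ l₂ => if φ.Sat x then η l₁ x else η l₂ x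
    | .demonic l₁ l₂ => max (η l₁ x) (η l₂ x)

/-- `G.Term l x`: if `l` is a branching label, then some transition of `l` with non-terminal target
is enabled at `x`; no condition at the other labels. -/
def CFG.Term {L X R : Type*} (G : CFG L X R) (l : L) (x : X → ℝ) : Prop :=
  match G.node l with
  | .branch φ l₁ l₂ => (l₁ ≠ none ∧ φ.Sat x) ∨ (l₂ ≠ none ∧ ¬ φ.Sat x)
  | _ => True

/-- `η` is a polynomial ranking supermartingale map of degree `d` with constants `ε` and `K`. -/
structure CFG.IsPRSM {L X R : Type*} [Fintype R] (G : CFG L X R) (S : Sampling R)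
    (I : LabelBot L → Pred X) (d : ℕ) (η : LabelBot L → (X → ℝ) → ℝ) (ε K : ℝ) : Prop where
  eps_pos : 0 < ε
  K_le : K ≤ -ε
  poly : ∀ l, ∃ p : MvPolynomial X ℝ, p.totalDegree ≤ d ∧ ∀ x, η l x = MvPolynomial.eval x p
  nonneg : ∀ (l : L) x, (I (some l)).Sat x → 0 ≤ η (some l) x
  terminal : ∀ x, η none x = K
  decrease : ∀ (l : L) x, (I (some l)).Sat x → G.Term l x →
    G.preExp S η (some l) x ≤ η (some l) x - ε

end PP

end

/- After one step `η` drops by at least `ε` in expectation, so `(η - K) / ε` is a non-negative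
potential that pays for one unit of time per step (the Foster criterion). A branching label exempt
from (C4) does no harm: its enabled transition leads to `⊥`, where `η` has fallen from a
non-negative value to `K ≤ -ε`. Conditions (C2) and (C4) are available at reachable configurations
only, and the set of those need not be measurable. Setting the potential to `∞` elsewhere makes the
drift inequality hold everywhere; its integral is then the lower integral of a possibly
non-measurable function, and the comparison is arranged so that this is all it needs. -/

namespace PP

open MeasureTheory ProbabilityTheory Preorder
open scoped ENNReal

section Trajectory

variable {E : ℕ → Type*} [∀ n, MeasurableSpace (E n)]
  (κ : (n : ℕ) → Kernel (Π i : Finset.Iic n, E i) (E (n + 1))) [∀ n, IsMarkovKernel (κ n)]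

theorem lintegral_partialTraj_succ_le (n : ℕ) (h : Π i : Finset.Iic n, E i)
    (f : E (n + 1) → ℝ≥0∞) :
    ∫⁻ h', f (h' ⟨n + 1, Finset.mem_Iic.2 le_rfl⟩) ∂Kernel.partialTraj κ n (n + 1) h ≤
      ∫⁻ e, f e ∂κ n h := by
  rw [Kernel.partialTraj_succ_self, Kernel.map_apply _ measurable_IicProdIoc, Kernel.prod_apply,
    Kernel.id_apply, Measure.dirac_prod,
    Kernel.map_apply _ (MeasurableEquiv.piSingleton n).measurable]
  refine (lintegral_map_le _ _).trans <| (lintegral_map_le _ _).trans <|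
    (lintegral_map_le _ _).trans (le_of_eq ?_)
  simp [IicProdIoc, MeasurableEquiv.piSingleton]

theorem lintegral_traj_comp_frestrictLe (n : ℕ) (h : Π i : Finset.Iic n, E i)
    {u : (Π i : Finset.Iic n, E i) → ℝ≥0∞} (hu : Measurable u) :
    ∫⁻ ω, u (frestrictLe n ω) ∂Kernel.traj κ n h = u h := by
  rw [← lintegral_map hu (measurable_frestrictLe n), Kernel.traj_map_frestrictLe_apply,
    Kernel.partialTraj_self, Kernel.id_apply, lintegral_dirac' h hu]

theorem lintegral_partialTraj_traj {m n : ℕ} (hmn : m ≤ n) (h : Π i : Finset.Iic m, E i)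
    {f : (Π k, E k) → ℝ≥0∞} (hf : Measurable f) :
    ∫⁻ h', ∫⁻ ω, f ω ∂Kernel.traj κ n h' ∂Kernel.partialTraj κ m n h =
      ∫⁻ ω, f ω ∂Kernel.traj κ m h := by
  rw [← Kernel.traj_comp_partialTraj hmn, Kernel.lintegral_comp _ _ _ hf]

variable {κ} {u V : (n : ℕ) → (Π i : Finset.Iic n, E i) → ℝ≥0∞}

theorem lintegral_traj_sum_Ico_le (hu : ∀ n, Measurable (u n))
    (hV : ∀ n h, u n h + ∫⁻ h', V (n + 1) h' ∂Kernel.partialTraj κ n (n + 1) h ≤ V n h)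
    (n N : ℕ) (h : Π i : Finset.Iic n, E i) :
    ∫⁻ ω, ∑ k ∈ Finset.Ico n N, u k (frestrictLe k ω) ∂Kernel.traj κ n h ≤ V n h := by
  have hu' (k : ℕ) : Measurable fun ω : Π k, E k => u k (frestrictLe k ω) :=
    (hu k).comp (measurable_frestrictLe k)
  induction hd : N - n generalizing n with
  | zero => simp [Finset.Ico_eq_empty_of_le (Nat.sub_eq_zero_iff_le.1 hd)]
  | succ d ih =>
    have hsum : Measurable fun ω : Π k, E k => ∑ k ∈ Finset.Ico (n + 1) N, u k (frestrictLe k ω) :=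
      Finset.measurable_sum _ fun k _ => hu' k
    calc ∫⁻ ω, ∑ k ∈ Finset.Ico n N, u k (frestrictLe k ω) ∂Kernel.traj κ n h
        = u n h + ∫⁻ h', ∫⁻ ω, ∑ k ∈ Finset.Ico (n + 1) N, u k (frestrictLe k ω)
            ∂Kernel.traj κ (n + 1) h' ∂Kernel.partialTraj κ n (n + 1) h := by
          simp_rw [Finset.sum_eq_sum_Ico_succ_bot (show n < N by lia)]
          rw [lintegral_add_left (hu' n), lintegral_traj_comp_frestrictLe κ n h (hu n),
            lintegral_partialTraj_traj κ n.le_succ h hsum]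
      _ ≤ u n h + ∫⁻ h', V (n + 1) h' ∂Kernel.partialTraj κ n (n + 1) h := by
          gcongr with h'
          exact ih (n + 1) h' (by lia)
      _ ≤ V n h := hV n h

theorem lintegral_traj_tsum_le (hu : ∀ n, Measurable (u n))
    (hV : ∀ n h, u n h + ∫⁻ h', V (n + 1) h' ∂Kernel.partialTraj κ n (n + 1) h ≤ V n h)
    (h : Π i : Finset.Iic 0, E i) :
    ∫⁻ ω, ∑' k, u k (frestrictLe k ω) ∂Kernel.traj κ 0 h ≤ V 0 h := by
  have hu' (k : ℕ) : Measurable fun ω : Π k, E k => u k (frestrictLe k ω) :=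
    (hu k).comp (measurable_frestrictLe k)
  rw [lintegral_tsum fun k => (hu' k).aemeasurable]
  refine ENNReal.tsum_le_of_sum_range_le fun N => ?_
  rw [← lintegral_finsetSum _ fun k _ => hu' k, Finset.range_eq_Ico]
  exact lintegral_traj_sum_Ico_le hu hV 0 N h

end Trajectory

section TerminationTime

variable {L X : Type*}

/-- The configurations at which a run has not yet terminated. -/
def nonterminal (L X : Type*) : Set (Config L X) := {c | c.1 ≠ none}

theorem measurableSet_nonterminal : MeasurableSet (nonterminal L X) :=
  measurable_fst (MeasurableSet.of_discrete (s := {none}ᶜ))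

theorem measurable_terminationTime :
    Measurable (terminationTime : (ℕ → Config L X) → ℝ≥0∞) := by
  classical
  refine .iInf fun n => ?_
  simp_rw [iInf_eq_if]
  have hs : MeasurableSet {ω : ℕ → Config L X | (ω n).1 = none} :=
    (measurable_fst.comp (measurable_pi_apply n)) (MeasurableSet.of_discrete (s := {none}))
  exact .ite hs measurable_const measurable_const

theorem terminationTime_le_tsum_nonterminal (ω : ℕ → Config L X) :
    terminationTime ω ≤ ∑' k, (nonterminal L X).indicator 1 (ω k) := by
  classical
  by_cases h : ∃ n, (ω n).1 = none
  · calc terminationTime ω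
      _ ≤ (Nat.find h : ℝ≥0∞) := iInf₂_le (Nat.find h) (Nat.find_spec h)
      _ = ∑ k ∈ Finset.range (Nat.find h), (nonterminal L X).indicator 1 (ω k) := by
        have hrun (k) (hk : k ∈ Finset.range (Nat.find h)) : ω k ∈ nonterminal L X :=
          Nat.find_min h (Finset.mem_range.1 hk)
        simp [Finset.sum_congr rfl fun k hk => Set.indicator_of_mem (hrun k hk) 1]
      _ ≤ ∑' k, (nonterminal L X).indicator 1 (ω k) := ENNReal.sum_le_tsum _
  · have hrun (k) : ω k ∈ nonterminal L X := not_exists.1 h k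
    simp [Set.indicator_of_mem (hrun _)]

end TerminationTime

section StepLaw

variable {L X R : Type*} [Finite X] [Fintype R] {G : CFG L X R} {S : Sampling R}

theorem Sampling.ae_joint_mem_supp (S : Sampling R) : ∀ᵐ r ∂S.joint, ∀ i, r i ∈ S.supp i :=
  Filter.eventually_all.2 fun i => Measure.tendsto_eval_ae_ae.eventually (S.ae_mem_supp i)

theorem CFG.lintegral_stepLaw_le_of_step {f g : Config L X → ℝ≥0∞} (hg : Measurable g) (b : Bool)
    {c : Config L X} (hfg : ∀ c', G.Step S c c' → f c' ≤ g c') :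
    ∫⁻ c', f c' ∂G.stepLaw S b c ≤ ∫⁻ c', g c' ∂G.stepLaw S b c := by
  obtain ⟨_ | l, x⟩ := c
  · simpa [CFG.stepLaw] using hfg _ rfl
  simp only [CFG.Step] at hfg
  simp only [CFG.stepLaw]
  cases hl : G.node l with
  | assign f' l' =>
    simp only [hl] at hfg ⊢
    rw [lintegral_map hg (measurable_const.prodMk (f'.measurable_apply_right x))]
    refine (lintegral_map_le _ _).trans (lintegral_mono_ae ?_)
    filter_upwards [S.ae_joint_mem_supp] with r hr using hfg _ ⟨r, hr, rfl⟩
  | prob p l₁ l₂ =>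
    simp only [hl, lintegral_add_measure, lintegral_smul_measure, lintegral_dirac] at hfg ⊢
    gcongr
    exacts [hfg _ (.inl rfl), hfg _ (.inr rfl)]
  | branch φ l₁ l₂ =>
    simp only [hl] at hfg ⊢
    split_ifs with hφ
    · simpa only [lintegral_dirac] using hfg _ (.inl ⟨hφ, rfl⟩)
    · simpa only [lintegral_dirac] using hfg _ (.inr ⟨hφ, rfl⟩)
  | demonic l₁ l₂ =>
    simp only [hl, lintegral_dirac] at hfg ⊢
    cases b
    exacts [hfg _ (.inr rfl), hfg _ (.inl rfl)]

theorem CFG.ae_stepLaw_of_step {s : Set (Config L X)} (hs : MeasurableSet s) (b : Bool)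
    {c : Config L X} (h : ∀ c', G.Step S c c' → c' ∈ s) : ∀ᵐ c' ∂G.stepLaw S b c, c' ∈ s := by
  have hle : ∫⁻ c', sᶜ.indicator 1 c' ∂G.stepLaw S b c ≤ ∫⁻ _, 0 ∂G.stepLaw S b c :=
    lintegral_stepLaw_le_of_step measurable_const b fun c' hc' => by simp [h c' hc']
  rw [lintegral_indicator_one hs.compl, lintegral_zero] at hle
  exact nonpos_iff_eq_zero.1 hle

theorem Sampling.integrable_joint_of_continuous (S : Sampling R) {f : (R → ℝ) → ℝ}
    (hf : Continuous f) : Integrable f S.joint := by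
  have hK : IsCompact (Set.univ.pi fun i => closure (S.supp i)) :=
    isCompact_univ_pi fun i => (S.supp_bounded i).isCompact_closure
  have hint := hf.continuousOn.integrableOn_compact (μ := S.joint) hK
  rwa [IntegrableOn, Measure.restrict_eq_self_of_ae_mem] at hint
  filter_upwards [S.ae_joint_mem_supp] with r hr using fun i _ => subset_closure (hr i)

theorem Update.continuous_apply_right {X R : Type*} (f : Update X R) (x : X → ℝ) :
    Continuous fun r : R → ℝ => f.apply x r := by
  refine continuous_pi fun i => (MvPolynomial.continuous_eval (f i)).comp ?_
  refine continuous_pi fun j => ?_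
  cases j with
  | inl a => exact continuous_const
  | inr a => exact continuous_apply a

theorem CFG.integrable_stepLaw_of_continuous [Finite L] {η : LabelBot L → (X → ℝ) → ℝ}
    (hη : ∀ l, Continuous (η l)) (b : Bool) (c : Config L X) :
    Integrable (fun c' => η c'.1 c'.2) (G.stepLaw S b c) := by
  have hm : Measurable fun c : Config L X => η c.1 c.2 :=
    measurable_from_prod_countable_right fun l => (hη l).measurable
  have hd (c') : Integrable (fun c' => η c'.1 c'.2) (Measure.dirac c' : Measure (Config L X)) :=
    integrable_dirac enorm_lt_top
  obtain ⟨_ | l, x⟩ := c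
  · exact hd _
  simp only [CFG.stepLaw]
  cases G.node l with
  | assign f l' =>
    refine (integrable_map_measure hm.aestronglyMeasurable
      (measurable_const.prodMk (f.measurable_apply_right x)).aemeasurable).2 ?_
    exact S.integrable_joint_of_continuous ((hη l').comp (f.continuous_apply_right x))
  | prob p l₁ l₂ =>
    exact ((hd _).smul_measure ENNReal.ofReal_ne_top).add_measure
      ((hd _).smul_measure ENNReal.ofReal_ne_top)
  | branch φ l₁ l₂ => dsimp only; split_ifs <;> exact hd _
  | demonic l₁ l₂ => exact hd _

theorem CFG.integral_stepLaw_le_preExp {η : LabelBot L → (X → ℝ) → ℝ}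
    (hη : Measurable fun c : Config L X => η c.1 c.2) (b : Bool) (c : Config L X) :
    ∫ c', η c'.1 c'.2 ∂G.stepLaw S b c ≤ G.preExp S η c.1 c.2 := by
  have hd (c') : Integrable (fun c' => η c'.1 c'.2) (Measure.dirac c' : Measure (Config L X)) :=
    integrable_dirac enorm_lt_top
  obtain ⟨_ | l, x⟩ := c
  · simp [CFG.stepLaw, CFG.preExp]
  simp only [CFG.stepLaw, CFG.preExp]
  cases G.node l with
  | assign f l' =>
    exact (integral_map (measurable_const.prodMk (f.measurable_apply_right x)).aemeasurable
      hη.aestronglyMeasurable).le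
  | prob p l₁ l₂ =>
    rw [integral_add_measure ((hd _).smul_measure ENNReal.ofReal_ne_top)
      ((hd _).smul_measure ENNReal.ofReal_ne_top)]
    simp [integral_smul_measure, p.2.1.le, p.2.2.le]
  | branch φ l₁ l₂ => dsimp only; split_ifs <;> simp
  | demonic l₁ l₂ => cases b <;> simp

end StepLaw

section RankingSupermartingale

variable {L X R : Type*} {G : CFG L X R} {S : Sampling R} {c₀ : Config L X}
  {η : LabelBot L → (X → ℝ) → ℝ} {ε K : ℝ}

/-- The potential `(η - K) / ε` at the configurations reachable from `c₀`, and `∞` elsewhere. -/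
noncomputable def CFG.potential (G : CFG L X R) (S : Sampling R) (c₀ : Config L X)
    (η : LabelBot L → (X → ℝ) → ℝ) (ε K : ℝ) (c : Config L X) : ℝ≥0∞ :=
  ⨅ _ : G.Reachable S c₀ c, ENNReal.ofReal ((η c.1 c.2 - K) / ε)

theorem CFG.potential_of_reachable {c : Config L X} (hc : G.Reachable S c₀ c) :
    G.potential S c₀ η ε K c = ENNReal.ofReal ((η c.1 c.2 - K) / ε) :=
  iInf_pos hc

variable [Fintype R]

/-- Ranking supermartingales for the runs from `c₀`: the notion behind `CFG.IsPRSM`, with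
polynomials replaced by measurable functions and the invariant by the reachable configurations.
Non-negativity at the labels and the value `K` at `⊥` are weakened to the common lower bound `K`;
in return, `η` has to decrease before every step from a label, including those that reach `⊥`. -/
structure CFG.IsRankingSupermartingale (G : CFG L X R) (S : Sampling R) (c₀ : Config L X)
    (η : LabelBot L → (X → ℝ) → ℝ) (ε K : ℝ) : Prop where
  eps_pos : 0 < ε
  measurable : Measurable fun c : Config L X => η c.1 c.2
  integrable : ∀ b c, G.Reachable S c₀ c → Integrable (fun c' => η c'.1 c'.2) (G.stepLaw S b c)
  le : ∀ c, G.Reachable S c₀ c → K ≤ η c.1 c.2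
  preExp_le : ∀ l x, G.Reachable S c₀ (some l, x) → G.preExp S η (some l) x ≤ η (some l) x - ε

namespace CFG.IsRankingSupermartingale

theorem ae_stepLaw_le [Finite X] (hη : G.IsRankingSupermartingale S c₀ η ε K) (b : Bool)
    {c : Config L X} (hc : G.Reachable S c₀ c) : ∀ᵐ c' ∂G.stepLaw S b c, K ≤ η c'.1 c'.2 :=
  ae_stepLaw_of_step (measurableSet_le measurable_const hη.measurable) b
    fun c' hc' => hη.le c' (.tail hc hc')

theorem lintegral_potential_stepLaw_le [Finite X] (hη : G.IsRankingSupermartingale S c₀ η ε K)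
    (b : Bool) {c : Config L X} (hc : G.Reachable S c₀ c) :
    ∫⁻ c', G.potential S c₀ η ε K c' ∂G.stepLaw S b c ≤
      ENNReal.ofReal ((∫ c', η c'.1 c'.2 ∂G.stepLaw S b c - K) / ε) := by
  have := G.isProbabilityMeasure_stepLaw S b c
  have hint := hη.integrable b c hc
  calc ∫⁻ c', G.potential S c₀ η ε K c' ∂G.stepLaw S b c
    _ ≤ ∫⁻ c', ENNReal.ofReal ((η c'.1 c'.2 - K) / ε) ∂G.stepLaw S b c :=
      lintegral_stepLaw_le_of_step ((hη.measurable.sub_const K).div_const ε).ennreal_ofReal b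
        fun c' hc' => (potential_of_reachable (.tail hc hc')).le
    _ = ENNReal.ofReal (∫ c', (η c'.1 c'.2 - K) / ε ∂G.stepLaw S b c) := by
      refine (ofReal_integral_eq_lintegral_ofReal
        ((hint.sub (integrable_const K)).div_const ε) ?_).symm
      filter_upwards [hη.ae_stepLaw_le b hc] with c' hK
      exact div_nonneg (sub_nonneg.2 hK) hη.eps_pos.le
    _ = ENNReal.ofReal ((∫ c', η c'.1 c'.2 ∂G.stepLaw S b c - K) / ε) := by
      rw [integral_div, integral_sub hint (integrable_const K), integral_const]
      simp

theorem one_add_lintegral_potential_stepLaw_le [Finite X]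
    (hη : G.IsRankingSupermartingale S c₀ η ε K) (b : Bool) {l : L} {x : X → ℝ}
    (hc : G.Reachable S c₀ (some l, x)) :
    1 + ∫⁻ c', G.potential S c₀ η ε K c' ∂G.stepLaw S b (some l, x) ≤
      G.potential S c₀ η ε K (some l, x) := by
  have := G.isProbabilityMeasure_stepLaw S b (some l, x)
  set m := ∫ c', η c'.1 c'.2 ∂G.stepLaw S b (some l, x)
  have hKm : K ≤ m := by
    simpa using integral_mono_ae (integrable_const K) (hη.integrable b _ hc)
      (hη.ae_stepLaw_le b hc)
  have hmε : m ≤ η (some l) x - ε :=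
    (integral_stepLaw_le_preExp hη.measurable b _).trans (hη.preExp_le l x hc)
  have hε := hη.eps_pos
  calc 1 + ∫⁻ c', G.potential S c₀ η ε K c' ∂G.stepLaw S b (some l, x)
    _ ≤ ENNReal.ofReal 1 + ENNReal.ofReal ((m - K) / ε) := by
      rw [ENNReal.ofReal_one]
      gcongr
      exact hη.lintegral_potential_stepLaw_le b hc
    _ = ENNReal.ofReal (1 + (m - K) / ε) :=
      (ENNReal.ofReal_add zero_le_one (div_nonneg (sub_nonneg.2 hKm) hε.le)).symm
    _ ≤ ENNReal.ofReal ((η (some l) x - K) / ε) := by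
      rw [one_add_div hε.ne']
      gcongr
      linarith
    _ = G.potential S c₀ η ε K (some l, x) := (potential_of_reachable hc).symm

theorem indicator_nonterminal_add_lintegral_potential_stepLaw_le [Finite X]
    (hη : G.IsRankingSupermartingale S c₀ η ε K) (b : Bool) (c : Config L X) :
    (nonterminal L X).indicator 1 c + ∫⁻ c', G.potential S c₀ η ε K c' ∂G.stepLaw S b c ≤
      G.potential S c₀ η ε K c := by
  by_cases hc : G.Reachable S c₀ c
  · obtain ⟨_ | l, x⟩ := c
    · simp [nonterminal, CFG.stepLaw]
    · simpa [nonterminal] using hη.one_add_lintegral_potential_stepLaw_le b hc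
  · simp [potential, hc]

variable [Finite L] [Finite X]

theorem lintegral_terminationTime_le (hη : G.IsRankingSupermartingale S c₀ η ε K)
    (σ : Scheduler L X) :
    ∫⁻ ω, terminationTime ω ∂G.runMeasure S c₀ σ ≤
      ENNReal.ofReal ((η c₀.1 c₀.2 - K) / ε) := by
  let u (n : ℕ) (h : Finset.Iic n → Config L X) : ℝ≥0∞ :=
    (nonterminal L X).indicator 1 (h ⟨n, Finset.mem_Iic.2 le_rfl⟩)
  let V (n : ℕ) (h : Finset.Iic n → Config L X) : ℝ≥0∞ :=
    G.potential S c₀ η ε K (h ⟨n, Finset.mem_Iic.2 le_rfl⟩)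
  have hu (n) : Measurable (u n) :=
    (measurable_one.indicator measurableSet_nonterminal).comp (measurable_pi_apply _)
  have hV (n) (h : Finset.Iic n → Config L X) :
      u n h + ∫⁻ h', V (n + 1) h' ∂Kernel.partialTraj (X := fun _ => Config L X)
        (G.stepKernel S σ) n (n + 1) h ≤ V n h := by
    grw [lintegral_partialTraj_succ_le]
    exact hη.indicator_nonterminal_add_lintegral_potential_stepLaw_le _ _
  calc ∫⁻ ω, terminationTime ω ∂G.runMeasure S c₀ σ
    _ ≤ ∫⁻ ω, ∑' k, u k (frestrictLe k ω) ∂G.runMeasure S c₀ σ :=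
      lintegral_mono terminationTime_le_tsum_nonterminal
    _ ≤ V 0 fun _ => c₀ := lintegral_traj_tsum_le hu hV _
    _ = ENNReal.ofReal ((η c₀.1 c₀.2 - K) / ε) := potential_of_reachable .refl

theorem ae_terminationTime_lt_top (hη : G.IsRankingSupermartingale S c₀ η ε K)
    (σ : Scheduler L X) : ∀ᵐ ω ∂G.runMeasure S c₀ σ, terminationTime ω < ∞ :=
  ae_lt_top measurable_terminationTime
    ((hη.lintegral_terminationTime_le σ).trans_lt ENNReal.ofReal_lt_top).ne

end CFG.IsRankingSupermartingale

end RankingSupermartingale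

instance CFG.isProbabilityMeasure_runMeasure {L X R : Type*} [Finite L] [Finite X] [Fintype R]
    (G : CFG L X R) (S : Sampling R) (c₀ : Config L X) (σ : Scheduler L X) :
    IsProbabilityMeasure (G.runMeasure S c₀ σ) := by
  unfold CFG.runMeasure; infer_instance

section PRSM

variable {L X R : Type*} [Fintype R] {G : CFG L X R} {S : Sampling R} {c₀ : Config L X}
  {I : LabelBot L → Pred X} {d : ℕ} {η : LabelBot L → (X → ℝ) → ℝ} {ε K : ℝ}

theorem CFG.preExp_of_not_term {l : L} {x : X → ℝ} (h : ¬ G.Term l x) :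
    G.preExp S η (some l) x = η none x := by
  simp only [CFG.Term] at h
  simp only [CFG.preExp]
  split at h
  · next φ l₁ l₂ hl =>
    rw [hl]
    grind
  · exact absurd trivial h

namespace CFG.IsPRSM

theorem continuous (hη : G.IsPRSM S I d η ε K) (l : LabelBot L) : Continuous (η l) := by
  obtain ⟨p, -, hp⟩ := hη.poly l
  exact (funext hp : η l = _) ▸ MvPolynomial.continuous_eval p

theorem le_of_reachable (hη : G.IsPRSM S I d η ε K) (hI : G.IsInvariant S c₀ I) {c : Config L X}
    (hc : G.Reachable S c₀ c) : K ≤ η c.1 c.2 := by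
  obtain ⟨_ | l, x⟩ := c
  · exact (hη.terminal x).ge
  · linarith [hη.nonneg l x (hI _ _ hc), hη.K_le, hη.eps_pos]

theorem preExp_le_of_sat (hη : G.IsPRSM S I d η ε K) {l : L} {x : X → ℝ}
    (hx : (I (some l)).Sat x) : G.preExp S η (some l) x ≤ η (some l) x - ε := by
  by_cases hterm : G.Term l x
  · exact hη.decrease l x hx hterm
  · rw [preExp_of_not_term hterm, hη.terminal]
    linarith [hη.nonneg l x hx, hη.K_le]

theorem isRankingSupermartingale [Finite L] [Finite X] (hη : G.IsPRSM S I d η ε K)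
    (hI : G.IsInvariant S c₀ I) : G.IsRankingSupermartingale S c₀ η ε K where
  eps_pos := hη.eps_pos
  measurable := measurable_from_prod_countable_right fun l => (hη.continuous l).measurable
  integrable b c _ := integrable_stepLaw_of_continuous hη.continuous b c
  le _ hc := hη.le_of_reachable hI hc
  preExp_le l x hc := hη.preExp_le_of_sat (hI (some l) x hc)

end CFG.IsPRSM

end PRSM

end PP

theorem theorem1_general {L X R : Type*} [Finite L] [Finite X] [Fintype R] (G : PP.CFG L X R)
    (S : PP.Sampling R) (c₀ : PP.Config L X) (η : PP.LabelBot L → (X → ℝ) → ℝ) (ε K : ℝ)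
    (hη : G.IsRankingSupermartingale S c₀ η ε K) :
    G.ASTerminating S c₀ ∧ G.ET S c₀ ≤ ENNReal.ofReal ((η c₀.1 c₀.2 - K) / ε) := by
  refine ⟨fun σ => ?_, iSup_le hη.lintegral_terminationTime_le⟩
  rw [MeasureTheory.measure_congr
    (Filter.eventuallyEq_univ.2 (hη.ae_terminationTime_lt_top σ)), MeasureTheory.measure_univ]

theorem theorem1 {X R : Type*} [Fintype X] [Fintype R] (P : PP.Program X R) (S : PP.Sampling R)
    (x₀ : X → ℝ) (I : PP.LabelBot P.Label → PP.Pred X)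
    (hI : P.cfg.IsInvariant S (some P.entry, x₀) I)
    (d : ℕ) (η : PP.LabelBot P.Label → (X → ℝ) → ℝ) (ε K : ℝ)
    (hη : P.cfg.IsPRSM S I d η ε K) :
    P.cfg.ASTerminating S (some P.entry, x₀) ∧
      P.cfg.ET S (some P.entry, x₀) ≤ ENNReal.ofReal ((η (some P.entry) x₀ - K) / ε) :=
  theorem1_general P.cfg S _ η ε K (hη.isRankingSupermartingale hI)
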